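/- Let $n\ge 0$ and let $\mathscr{E}$ be the ring of germs at the origin of smooth ($C^\infty$) real-valued maps of $n$ real variables $X=(x_1,\dots,x_n)$. For $f\in\mathscr{E}$ let $J^\infty(f)=\sum_\alpha a_\alpha X^\alpha$ be its Taylor series at the origin, let ${\rm Terms}(f)=\{a_\alpha X^\alpha : a_\alpha\neq 0\}$, and call $f$ flat if $J^\infty(f)=0$. A local order $\prec$ is a strict total order on the monomials $X^\alpha$, $\alpha\in\mathbb{Z}_{\ge 0}^n$, such that $X^\alpha\prec X^\beta$ implies $X^{\alpha+\gamma}\prec X^{\beta+\gamma}$ for all $\gamma$, and $x_i\prec 1$ for $i=1,\dots,n$. For a non-flat germ $f$ the leading term $LT(f)$ is the $\prec$-largest term in ${\rm Terms}(f)$ and $LC(f)$ is its coefficient; for a flat germ $LT(f)=0$. For an ideal $I\subseteq\mathscr{E}$ put $LT(I)=\langle LT(f) : f\in I\rangle_{\mathscr{E}}$. A finite generating set $G$ of $I$ is a standard basis of $I$ if $LT(I)=\langle LT(g) : g\in G\rangle_{\mathscr{E}}$. A standard basis $G$ is called reduced if $LC(g)=1$ for every non-flat $g\in G$, and, for all $g,h\in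 G$ and $p\in{\rm Terms}(h)$, $LT(g)$ does not divide $p$ in $\mathscr{E}$ except when $g=h$ and $p=LT(g)$. (Flat members are allowed: they may be needed to generate $I$.) Theorem. Let $\prec$ be any local order and let $I\subseteq\mathscr{E}$ be a finitely generated ideal. Then $I$ has a reduced standard basis. It is unique modulo flat germs: if $G$ and $G'$ are two reduced standard bases of $I$, then there is a bijection $e$ from the set of non-flat members of $G$ onto the set of non-flat members of $G'$ such that $e(g)-g$ is flat for every non-flat $g\in G$. -/

import Mathlib

open Filter Topology
open scoped ContDiff

noncomputable section

/-- A function is smooth near the origin of `ℝⁿ`: it is `C^∞` at every point of some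
neighbourhood of the origin. -/
def SmoothNearZero {n : ℕ} (f : (Fin n → ℝ) → ℝ) : Prop :=
  ∀ᶠ y in 𝓝 (0 : Fin n → ℝ), ContDiffAt ℝ ∞ f y

/-- The ring of germs at the origin of smooth real-valued maps in `n` real variables, as a subring
of the ring of all germs at the origin. -/
def smoothGermSubring (n : ℕ) : Subring (Germ (𝓝 (0 : Fin n → ℝ)) ℝ) where
  carrier := {φ | ∃ f : (Fin n → ℝ) → ℝ, SmoothNearZero f ∧ φ = Germ.ofFun f}
  mul_mem' := by
    rintro _ _ ⟨f, hf, rfl⟩ ⟨g, hg, rfl⟩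
    exact ⟨f * g, by filter_upwards [hf, hg] with y h1 h2 using h1.mul h2, rfl⟩
  one_mem' := ⟨1, Eventually.of_forall fun _ => contDiffAt_const, rfl⟩
  add_mem' := by
    rintro _ _ ⟨f, hf, rfl⟩ ⟨g, hg, rfl⟩
    exact ⟨f + g, by filter_upwards [hf, hg] with y h1 h2 using h1.add h2, rfl⟩
  zero_mem' := ⟨0, Eventually.of_forall fun _ => contDiffAt_const, rfl⟩
  neg_mem' := by
    rintro _ ⟨f, hf, rfl⟩
    exact ⟨-f, by filter_upwards [hf] with y h1 using h1.neg, rfl⟩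

/-- The ring of smooth germs at the origin of `ℝⁿ`. -/
abbrev SmoothGerm (n : ℕ) : Type := smoothGermSubring n

namespace SmoothGerm

variable {n : ℕ}

/-- The germ of a function that is smooth near the origin. -/
def mk (f : (Fin n → ℝ) → ℝ) (hf : SmoothNearZero f) : SmoothGerm n :=
  ⟨Germ.ofFun f, f, hf, rfl⟩

/-- The value of a smooth germ at the origin. -/
def value (φ : SmoothGerm n) : ℝ := (φ : Germ (𝓝 (0 : Fin n → ℝ)) ℝ).value

/-- The partial derivative `∂/∂xᵢ` on smooth germs. -/
def pderiv (i : Fin n) (φ : SmoothGerm n) : SmoothGerm n :=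
  ⟨Germ.map' (fun (f : (Fin n → ℝ) → ℝ) y => fderiv ℝ f y (Pi.single i 1))
      (fun f g h => by
        filter_upwards [Filter.EventuallyEq.fderiv (𝕜 := ℝ) h] with y hy
        rw [hy])
      (φ : Germ (𝓝 (0 : Fin n → ℝ)) ℝ), by
    obtain ⟨_, f, hf, rfl⟩ := φ
    refine ⟨fun y => fderiv ℝ f y (Pi.single i 1), ?_, rfl⟩
    filter_upwards [hf] with y hy
    exact (hy.fderiv_right (m := ∞) le_rfl).clm_apply contDiffAt_const⟩

/-- The higher partial derivative `∂^α = ∂₁^{α₁} ⋯ ∂ₙ^{αₙ}` on smooth germs. -/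
def iteratedPDeriv (α : Fin n →₀ ℕ) (φ : SmoothGerm n) : SmoothGerm n :=
  (List.finRange n).foldr (fun i ψ => (pderiv i)^[α i] ψ) φ

/-- The infinite jet of a smooth germ: its Taylor series at the origin, whose coefficient at `X^α`
is `∂^α φ(0) / α!`. -/
def jet (φ : SmoothGerm n) : MvPowerSeries (Fin n) ℝ :=
  fun α => (iteratedPDeriv α φ).value / ∏ i, ((α i).factorial : ℝ)

/-- The Taylor coefficient of a smooth germ at `X^α`. -/
def coeff (α : Fin n →₀ ℕ) (φ : SmoothGerm n) : ℝ := MvPowerSeries.coeff α (jet φ)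

/-- A germ is flat when its infinite jet vanishes. -/
def IsFlat (φ : SmoothGerm n) : Prop := jet φ = 0

/-- The germ `c X^α`. -/
def term (α : Fin n →₀ ℕ) (c : ℝ) : SmoothGerm n :=
  mk (fun y => c * ∏ i, y i ^ α i) (Eventually.of_forall fun _ => by fun_prop)

/-- The set of the terms `a_α X^α`, `a_α ≠ 0`, of the Taylor series of a germ. -/
def terms (φ : SmoothGerm n) : Set (SmoothGerm n) :=
  {p | ∃ α : Fin n →₀ ℕ, coeff α φ ≠ 0 ∧ p = term α (coeff α φ)}

end SmoothGerm

/-- A local order on the monomials `X^α` in `n` variables; the monomial `X^α` is represented by its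
exponent `α`, so that `1` is represented by `0` and `xᵢ` by `Finsupp.single i 1`. -/
structure LocalOrder (n : ℕ) where
  /-- `lt α β` means `X^α ≺ X^β`. -/
  lt : (Fin n →₀ ℕ) → (Fin n →₀ ℕ) → Prop
  isStrictTotalOrder : IsStrictTotalOrder (Fin n →₀ ℕ) lt
  lt_add_right : ∀ α β γ, lt α β → lt (α + γ) (β + γ)
  var_lt_one : ∀ i, lt (Finsupp.single i 1) 0

namespace LocalOrder

variable {n : ℕ} (o : LocalOrder n)

/-- `X^α` is the largest monomial that occurs in the Taylor series of `φ`. -/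
def IsLeadingExponent (φ : SmoothGerm n) (α : Fin n →₀ ℕ) : Prop :=
  SmoothGerm.coeff α φ ≠ 0 ∧ ∀ β, SmoothGerm.coeff β φ ≠ 0 → β ≠ α → o.lt β α

/-- Divisible monomials are smaller. -/
theorem eq_or_lt_of_le {α β : Fin n →₀ ℕ} (h : α ≤ β) : β = α ∨ o.lt β α := by
  have := o.isStrictTotalOrder
  have key : ∀ γ : Fin n →₀ ℕ, γ = 0 ∨ o.lt γ 0 := by
    intro γ
    induction γ using Finsupp.induction_linear with
    | zero => exact Or.inl rfl
    | add f g hf hg =>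
      rcases hf with rfl | hf
      · simpa using hg
      · right
        have h1 := o.lt_add_right f 0 g hf
        rw [zero_add] at h1
        rcases hg with rfl | hg
        · exact h1
        · exact _root_.trans h1 hg
    | single i k =>
      induction k with
      | zero => left; simp
      | succ k ih =>
        right
        have h1 := o.lt_add_right (Finsupp.single i 1) 0 (Finsupp.single i k) (o.var_lt_one i)
        rw [zero_add, ← Finsupp.single_add, add_comm] at h1
        rcases ih with ih | ih
        · rwa [ih] at h1
        · exact _root_.trans h1 ih
  obtain ⟨γ, rfl⟩ := exists_add_of_le h
  rcases key γ with rfl | hγ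
  · left; simp
  · right
    have h1 := o.lt_add_right γ 0 α hγ
    rwa [zero_add, add_comm] at h1

/-- Every non-flat germ has a leading monomial. -/
theorem exists_isLeadingExponent {φ : SmoothGerm n} (h : ¬ φ.IsFlat) :
    ∃ α, o.IsLeadingExponent φ α := by
  have := o.isStrictTotalOrder
  have hwf : WellFounded (fun α β => o.lt β α) := by
    rw [RelEmbedding.wellFounded_iff_isEmpty]
    refine ⟨fun e => ?_⟩
    have hlt : ∀ a b : ℕ, a < b → o.lt (e a) (e b) := fun a b hab => e.map_rel_iff.2 hab
    obtain ⟨a, b, hab, hle⟩ :=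
      (wellQuasiOrderedLE_def (Fin n →₀ ℕ)).1 inferInstance (fun k => e k)
    have h2 := hlt a b hab
    rcases o.eq_or_lt_of_le hle with h3 | h3
    · rw [h3] at h2
      exact irrefl _ h2
    · exact irrefl _ (_root_.trans h2 h3)
  have hne : {α | SmoothGerm.coeff α φ ≠ 0}.Nonempty := by
    by_contra hcon
    apply h
    ext α
    by_contra hα
    exact hcon ⟨α, hα⟩
  refine ⟨hwf.min _ hne, hwf.min_mem _ hne, fun β hβ hβα => ?_⟩
  have h1 : ¬ o.lt (hwf.min _ hne) β := hwf.not_lt_min {α | SmoothGerm.coeff α φ ≠ 0} hβ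
  rcases trichotomous_of o.lt β (hwf.min _ hne) with h2 | h2 | h2
  · exact h2
  · exact absurd h2 hβα
  · exact absurd h2 h1

open Classical in
/-- The leading coefficient of a germ; it is `0` for flat germs. -/
def leadingCoeff (φ : SmoothGerm n) : ℝ :=
  if h : φ.IsFlat then 0 else SmoothGerm.coeff (o.exists_isLeadingExponent h).choose φ

open Classical in
/-- The leading term of a germ: the maximum of its terms for a non-flat germ, and `0` for a flat
germ. -/
def leadingTerm (φ : SmoothGerm n) : SmoothGerm n :=
  if h : φ.IsFlat then 0
  else SmoothGerm.term (o.exists_isLeadingExponent h).choose (o.leadingCoeff φ)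

/-- The ideal generated by the leading terms of the members of `I`. -/
def leadingTermIdeal (I : Ideal (SmoothGerm n)) : Ideal (SmoothGerm n) :=
  Ideal.span (o.leadingTerm '' (I : Set (SmoothGerm n)))

/-- A standard basis of `I`: a finite generating set of `I` whose leading terms generate the leading
term ideal of `I`. -/
def IsStandardBasis (I : Ideal (SmoothGerm n)) (G : Finset (SmoothGerm n)) : Prop :=
  Ideal.span (G : Set (SmoothGerm n)) = I ∧
    o.leadingTermIdeal I = Ideal.span (o.leadingTerm '' (G : Set (SmoothGerm n)))

/-- A reduced standard basis of `I`. A finitely generated ideal of smooth germs may need flat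
germs in any generating set; such members have leading term `0`, and the normalization of the
leading coefficient applies to the other members only. -/
def IsReducedStandardBasis (I : Ideal (SmoothGerm n)) (G : Finset (SmoothGerm n)) : Prop :=
  o.IsStandardBasis I G ∧
    (∀ g ∈ G, ¬ g.IsFlat → o.leadingCoeff g = 1) ∧
    ∀ g ∈ G, ∀ h ∈ G, ∀ p ∈ h.terms, o.leadingTerm g ∣ p → g = h ∧ p = o.leadingTerm g

end LocalOrder

end

noncomputable section

/-! ### Germs and commuting partial derivatives. -/

namespace SmoothGerm

variable {n : ℕ}

/-! Leading terms depend only on jets. The jet is a ring homomorphism onto formal power series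
(`jet_mul`, and Borel's theorem `jet_surjective`), so division of power series (`exists_division`)
lifts to germs modulo flat germs.

By Dickson's lemma the leading exponents of `I` have finitely many minimal elements, the corners. A
member of `I` with no monomial above a corner is flat, since its leading exponent would lie above
one (`isFlat_of_coeff_eq_zero`). Dividing `X^α`, for a corner `α`, by monic members of `I` with the
corners as leading exponents gives a member of `I` whose only monomial above a corner is `X^α`
(`exists_isReducedAt`). These members, together with the flat remainders of a finite generating set,
form a reduced standard basis.

Conversely, each non-flat member of a reduced standard basis has this form at some corner, and two
members of `I` reduced at the same corner differ by a flat germ. Matching corners gives the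
bijection. -/

theorem exists_mk_eq (φ : SmoothGerm n) : ∃ f hf, φ = mk f hf := by
  obtain ⟨_, f, hf, rfl⟩ := φ
  exact ⟨f, hf, rfl⟩

theorem mk_eq_mk {f g : (Fin n → ℝ) → ℝ} {hf : SmoothNearZero f} {hg : SmoothNearZero g}
    (h : f =ᶠ[𝓝 0] g) : mk f hf = mk g hg :=
  Subtype.ext (Germ.coe_eq.2 h)

theorem _root_.SmoothNearZero.pderiv {f : (Fin n → ℝ) → ℝ} (hf : SmoothNearZero f) (i : Fin n) :
    SmoothNearZero fun y => fderiv ℝ f y (Pi.single i 1) := by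
  filter_upwards [hf] with y hy
  exact (hy.fderiv_right (m := ∞) le_rfl).clm_apply contDiffAt_const

theorem pderiv_mk (i : Fin n) (f : (Fin n → ℝ) → ℝ) (hf : SmoothNearZero f) :
    pderiv i (mk f hf) = mk (fun y => fderiv ℝ f y (Pi.single i 1)) (hf.pderiv i) := rfl

@[simp] theorem value_mk (f : (Fin n → ℝ) → ℝ) (hf : SmoothNearZero f) :
    (mk f hf).value = f 0 := rfl

@[simp] theorem value_add (φ ψ : SmoothGerm n) : (φ + ψ).value = φ.value + ψ.value := by
  obtain ⟨_, f, hf, rfl⟩ := φ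
  obtain ⟨_, g, hg, rfl⟩ := ψ
  rfl

@[simp] theorem value_mul (φ ψ : SmoothGerm n) : (φ * ψ).value = φ.value * ψ.value := by
  obtain ⟨_, f, hf, rfl⟩ := φ
  obtain ⟨_, g, hg, rfl⟩ := ψ
  rfl

theorem pderiv_add (i : Fin n) (φ ψ : SmoothGerm n) :
    pderiv i (φ + ψ) = pderiv i φ + pderiv i ψ := by
  obtain ⟨_, f, hf, rfl⟩ := φ
  obtain ⟨_, g, hg, rfl⟩ := ψ
  refine Subtype.ext (Germ.coe_eq.2 ?_)
  filter_upwards [hf, hg] with y hy hy'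
  have := fderiv_fun_add (hy.differentiableAt (by simp)) (hy'.differentiableAt (by simp))
  rw [this]
  rfl

theorem pderiv_mul (i : Fin n) (φ ψ : SmoothGerm n) :
    pderiv i (φ * ψ) = φ * pderiv i ψ + pderiv i φ * ψ := by
  obtain ⟨_, f, hf, rfl⟩ := φ
  obtain ⟨_, g, hg, rfl⟩ := ψ
  refine Subtype.ext (Germ.coe_eq.2 ?_)
  filter_upwards [hf, hg] with y hy hy'
  have := fderiv_fun_mul (hy.differentiableAt (by simp)) (hy'.differentiableAt (by simp))
  rw [this]
  simp [mul_comm]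

theorem two_le_infty : (2 : ℕ∞ω) ≤ ∞ :=
  WithTop.coe_le_coe.2 (le_top (a := (2 : ℕ∞)))

theorem pderiv_comm (i j : Fin n) (φ : SmoothGerm n) :
    pderiv i (pderiv j φ) = pderiv j (pderiv i φ) := by
  obtain ⟨f, hf, rfl⟩ := exists_mk_eq φ
  rw [pderiv_mk, pderiv_mk, pderiv_mk, pderiv_mk]
  refine mk_eq_mk ?_
  filter_upwards [hf] with y hy
  have hd : DifferentiableAt ℝ (fderiv ℝ f) y :=
    (hy.fderiv_right (m := 1) (by rw [one_add_one_eq_two]; exact two_le_infty)).differentiableAt (by simp)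
  rw [fderiv_clm_apply hd (differentiableAt_const _), fderiv_clm_apply hd (differentiableAt_const _)]
  simpa using (hy.isSymmSndFDerivAt (by simpa using two_le_infty)).eq (Pi.single i 1) (Pi.single j 1)

theorem pderiv_iterate_comm (i j : Fin n) (k : ℕ) (φ : SmoothGerm n) :
    pderiv i ((pderiv j)^[k] φ) = (pderiv j)^[k] (pderiv i φ) :=
  Function.Commute.iterate_right (f := pderiv i) (g := pderiv j) (pderiv_comm i j) k φ

theorem pderiv_foldr_comm (i : Fin n) (a : Fin n → ℕ) (L : List (Fin n)) (φ : SmoothGerm n) :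
    pderiv i (L.foldr (fun j ψ => (pderiv j)^[a j] ψ) φ) =
      L.foldr (fun j ψ => (pderiv j)^[a j] ψ) (pderiv i φ) := by
  induction L with
  | nil => rfl
  | cons j L ih => rw [List.foldr_cons, pderiv_iterate_comm, ih, List.foldr_cons]

theorem foldr_pderiv_of_notMem (i : Fin n) (α : Fin n →₀ ℕ) (L : List (Fin n)) (h : i ∉ L)
    (φ : SmoothGerm n) :
    L.foldr (fun j ψ => (pderiv j)^[(α + Finsupp.single i 1 : Fin n →₀ ℕ) j] ψ) φ =
      L.foldr (fun j ψ => (pderiv j)^[α j] ψ) φ := by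
  induction L with
  | nil => rfl
  | cons j L ih =>
    rw [List.mem_cons, not_or] at h
    rw [List.foldr_cons, List.foldr_cons, ih h.2, Finsupp.add_apply,
      Finsupp.single_eq_of_ne (Ne.symm h.1), add_zero]

/-- Since `i` occurs only once in `L`, there is a single extra derivative; it commutes inwards past
the derivatives of the tail. -/
theorem foldr_pderiv_of_mem (i : Fin n) (α : Fin n →₀ ℕ) (L : List (Fin n)) (hL : L.Nodup)
    (h : i ∈ L) (φ : SmoothGerm n) :
    L.foldr (fun j ψ => (pderiv j)^[(α + Finsupp.single i 1 : Fin n →₀ ℕ) j] ψ) φ =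
      L.foldr (fun j ψ => (pderiv j)^[α j] ψ) (pderiv i φ) := by
  induction L with
  | nil => simp at h
  | cons j L ih =>
    rw [List.nodup_cons] at hL
    rw [List.foldr_cons, List.foldr_cons]
    by_cases hij : j = i
    · subst hij
      rw [foldr_pderiv_of_notMem _ _ _ hL.1, Finsupp.add_apply, Finsupp.single_eq_same,
        Function.iterate_succ_apply, pderiv_foldr_comm]
    · rw [ih hL.2 (List.mem_of_ne_of_mem (Ne.symm hij) h), Finsupp.add_apply,
        Finsupp.single_eq_of_ne hij, add_zero]

theorem iteratedPDeriv_pderiv (i : Fin n) (α : Fin n →₀ ℕ) (φ : SmoothGerm n) :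
    iteratedPDeriv α (pderiv i φ) = iteratedPDeriv (α + Finsupp.single i 1) φ :=
  (foldr_pderiv_of_mem i α _ (List.nodup_finRange n) (List.mem_finRange i) φ).symm

/-! ### The jet as a ring homomorphism. -/

theorem coeff_eq (α : Fin n →₀ ℕ) (φ : SmoothGerm n) :
    coeff α φ = (iteratedPDeriv α φ).value / ∏ i, ((α i).factorial : ℝ) := rfl

theorem jet_pderiv (i : Fin n) (φ : SmoothGerm n) :
    jet (pderiv i φ) = MvPowerSeries.pderiv ℝ i (jet φ) := by
  classical
  ext α
  rw [MvPowerSeries.coeff_pderiv]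
  change coeff _ _ = coeff _ _ * _
  rw [coeff_eq, coeff_eq, iteratedPDeriv_pderiv]
  have h : ∏ j, (((α + Finsupp.single i 1 : Fin n →₀ ℕ) j).factorial : ℝ) =
      (α i + 1) * ∏ j, ((α j).factorial : ℝ) := by
    rw [← Finset.mul_prod_erase _ _ (Finset.mem_univ i),
      ← Finset.mul_prod_erase Finset.univ (fun j => ((α j).factorial : ℝ)) (Finset.mem_univ i)]
    rw [Finset.prod_congr rfl (g := fun j => ((α j).factorial : ℝ))]
    · simp [Nat.factorial_succ, mul_assoc]
    · intro j hj
      rw [Finsupp.add_apply, Finsupp.single_eq_of_ne (Finset.ne_of_mem_erase hj), add_zero]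
  rw [h]
  have h1 : ∏ j, ((α j).factorial : ℝ) ≠ 0 :=
    Finset.prod_ne_zero_iff.2 fun j _ => by positivity
  have h2 : (α i + 1 : ℝ) ≠ 0 := by positivity
  field_simp

theorem constantCoeff_jet (φ : SmoothGerm n) :
    MvPowerSeries.constantCoeff (jet φ) = φ.value := by
  have h : ∀ L : List (Fin n),
      L.foldr (fun j ψ => (pderiv j)^[(0 : Fin n →₀ ℕ) j] ψ) φ = φ := by
    intro L
    induction L with
    | nil => rfl
    | cons j L ih => rw [List.foldr_cons, ih]; rfl
  change (iteratedPDeriv 0 φ).value / _ = _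
  rw [iteratedPDeriv, h]
  simp

/-- Two operations that build power series agree when they have the same constant terms and are
compatible with the partial derivatives. -/
theorem _root_.MvPowerSeries.eq_of_forall_pderiv {ι σ : Type*}
    (F G : ι → MvPowerSeries σ ℝ)
    (h0 : ∀ x, MvPowerSeries.constantCoeff (F x) = MvPowerSeries.constantCoeff (G x))
    (hs : ∀ i x (α : σ →₀ ℕ),
      (∀ y, MvPowerSeries.coeff α (F y) = MvPowerSeries.coeff α (G y)) →
      MvPowerSeries.coeff α (MvPowerSeries.pderiv ℝ i (F x)) =
        MvPowerSeries.coeff α (MvPowerSeries.pderiv ℝ i (G x))) (x : ι) : F x = G x := by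
  ext α
  induction hd : α.degree generalizing α x with
  | zero =>
    obtain rfl : α = 0 := (Finsupp.degree_eq_zero_iff α).1 hd
    simpa using h0 x
  | succ d ih =>
    have hα : α ≠ 0 := by rintro rfl; simp at hd
    obtain ⟨i, hi⟩ := Finsupp.ne_iff.1 hα
    have hle : Finsupp.single i 1 ≤ α := by
      rw [Finsupp.single_le_iff]; exact Nat.one_le_iff_ne_zero.2 hi
    obtain ⟨β, rfl⟩ := exists_add_of_le hle
    rw [add_comm] at hd ⊢
    have hβ : β.degree = d := by
      simpa using hd
    have := hs i x β fun y => ih y β hβ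
    rw [MvPowerSeries.coeff_pderiv, MvPowerSeries.coeff_pderiv] at this
    -- The factor `β i + 1` produced by differentiating is invertible in characteristic zero.
    exact mul_right_cancel₀ (by positivity) this

theorem jet_add (φ ψ : SmoothGerm n) : jet (φ + ψ) = jet φ + jet ψ := by
  refine MvPowerSeries.eq_of_forall_pderiv
    (fun x : SmoothGerm n × SmoothGerm n => jet (x.1 + x.2)) (fun x => jet x.1 + jet x.2)
    (fun x => by simp [constantCoeff_jet]) (fun i x α h => ?_) (φ, ψ)
  simpa [← jet_pderiv, pderiv_add] using h (pderiv i x.1, pderiv i x.2)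

/-- Both sides obey the Leibniz rule. Indexing by pairs lets the induction on degree use the pairs
`(∂φ, ψ)` and `(φ, ∂ψ)`. -/
theorem jet_mul (φ ψ : SmoothGerm n) : jet (φ * ψ) = jet φ * jet ψ := by
  refine MvPowerSeries.eq_of_forall_pderiv
    (fun x : SmoothGerm n × SmoothGerm n => jet (x.1 * x.2)) (fun x => jet x.1 * jet x.2)
    (fun x => by simp [constantCoeff_jet]) (fun i x α h => ?_) (φ, ψ)
  have h1 := h (pderiv i x.1, x.2)
  have h2 := h (x.1, pderiv i x.2)
  simp only at h1 h2
  simp only [← jet_pderiv, pderiv_mul, jet_add, map_add, Derivation.leibniz, smul_eq_mul, h1, h2]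
  rw [mul_comm (jet x.2)]

theorem smoothNearZero_const (c : ℝ) : SmoothNearZero fun _ : Fin n → ℝ => c :=
  Eventually.of_forall fun _ => contDiffAt_const

theorem smoothNearZero_coord (i : Fin n) : SmoothNearZero fun y : Fin n → ℝ => y i :=
  Eventually.of_forall fun _ => by fun_prop

/-- The germ of a constant function. -/
def const (c : ℝ) : SmoothGerm n :=
  mk (fun _ => c) (smoothNearZero_const c)

/-- The germ of a coordinate function. -/
def coord (i : Fin n) : SmoothGerm n :=
  mk (fun y => y i) (smoothNearZero_coord i)

theorem jet_zero : jet (0 : SmoothGerm n) = 0 := by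
  simpa using jet_add (0 : SmoothGerm n) 0

theorem jet_const (c : ℝ) : jet (const c : SmoothGerm n) = MvPowerSeries.C c := by
  refine MvPowerSeries.pderiv.ext (fun i => ?_) (by simp [constantCoeff_jet, const])
  have : pderiv i (const c : SmoothGerm n) = 0 := by
    rw [const, pderiv_mk]
    refine Subtype.ext (Germ.coe_eq.2 (Eventually.of_forall fun y => ?_))
    simp
  rw [← jet_pderiv, this, jet_zero, MvPowerSeries.pderiv_C]

theorem jet_one : jet (1 : SmoothGerm n) = 1 := by
  have : (1 : SmoothGerm n) = const 1 := rfl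
  rw [this, jet_const, map_one]

theorem jet_coord (i : Fin n) : jet (coord i : SmoothGerm n) = MvPowerSeries.X i := by
  classical
  refine MvPowerSeries.pderiv.ext (fun j => ?_) (by simp [constantCoeff_jet, coord])
  have : pderiv j (coord i : SmoothGerm n) = const (if j = i then 1 else 0) := by
    rw [coord, pderiv_mk]
    refine mk_eq_mk (Eventually.of_forall fun y => ?_)
    have h : fderiv ℝ (fun y : Fin n → ℝ => y i) y = ContinuousLinearMap.proj i :=
      (ContinuousLinearMap.proj (R := ℝ) (φ := fun _ : Fin n => ℝ) i).fderiv
    simp [h, Pi.single_apply, eq_comm]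
  rw [← jet_pderiv, this, jet_const, MvPowerSeries.pderiv_X, Pi.single_apply]
  simp [apply_ite MvPowerSeries.C, eq_comm]

/-- The infinite jet as a ring homomorphism. -/
def jetHom (n : ℕ) : SmoothGerm n →+* MvPowerSeries (Fin n) ℝ where
  toFun := jet
  map_one' := jet_one
  map_mul' := jet_mul
  map_zero' := jet_zero
  map_add' := jet_add

@[simp] theorem jetHom_apply (φ : SmoothGerm n) : jetHom n φ = jet φ := rfl

theorem term_eq (α : Fin n →₀ ℕ) (c : ℝ) : term α c = const c * ∏ i, coord i ^ α i := by
  apply Subtype.ext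
  simp only [Subring.coe_mul, SubmonoidClass.coe_finsetProd, SubmonoidClass.coe_pow]
  have h : ∀ (s : Finset (Fin n)) (F : Fin n → (Fin n → ℝ) → ℝ),
      ∏ i ∈ s, (Germ.ofFun (F i) : Germ (𝓝 (0 : Fin n → ℝ)) ℝ) =
        Germ.ofFun (fun y => ∏ i ∈ s, F i y) := by
    intro s F
    induction s using Finset.cons_induction with
    | empty => rfl
    | cons i s his ih =>
      simp only [Finset.prod_cons, ih]
      rfl
  exact congrArg (fun z => (Germ.ofFun (fun _ => c) : Germ (𝓝 (0 : Fin n → ℝ)) ℝ) * z)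
    (h Finset.univ (fun i y => y i ^ α i)).symm

theorem jet_term (α : Fin n →₀ ℕ) (c : ℝ) : jet (term α c) = MvPowerSeries.monomial α c := by
  rw [term_eq, jet_mul, jet_const, ← jetHom_apply (∏ i, coord i ^ α i), map_prod]
  simp only [map_pow, jetHom_apply, jet_coord]
  rw [MvPowerSeries.monomial_eq', Finsupp.prod_fintype _ _ fun i => pow_zero _]

open Classical in
theorem coeff_term (α β : Fin n →₀ ℕ) (c : ℝ) :
    coeff β (term α c) = if β = α then c else 0 := by
  rw [coeff, jet_term, MvPowerSeries.coeff_monomial]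

/-! ### Borel's theorem. -/

theorem smoothNearZero_iteratedFDeriv {f : (Fin n → ℝ) → ℝ} (hf : SmoothNearZero f) (k : ℕ)
    (v : Fin k → Fin n → ℝ) : SmoothNearZero fun y => iteratedFDeriv ℝ k f y v := by
  filter_upwards [hf] with y hy
  have h : ContDiffAt ℝ ∞ (iteratedFDeriv ℝ k f) y :=
    hy.iteratedFDeriv_right (m := ∞) le_rfl
  exact (ContinuousMultilinearMap.apply ℝ (fun _ : Fin k => Fin n → ℝ) ℝ v).contDiff.contDiffAt.comp
    y h

/-- The operator `T` on smooth germs is an iterated directional derivative. -/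
def IsDirectionalDeriv (T : SmoothGerm n → SmoothGerm n) : Prop :=
  ∃ (k : ℕ) (v : Fin k → Fin n → ℝ), ∀ (f : (Fin n → ℝ) → ℝ) (hf : SmoothNearZero f),
    T (mk f hf) = mk (fun y => iteratedFDeriv ℝ k f y v) (smoothNearZero_iteratedFDeriv hf k v)

theorem IsDirectionalDeriv.id : IsDirectionalDeriv fun φ : SmoothGerm n => φ :=
  ⟨0, Fin.elim0, fun _ _ => mk_eq_mk (Eventually.of_forall fun _ => by simp)⟩

theorem IsDirectionalDeriv.pderiv {T : SmoothGerm n → SmoothGerm n} (hT : IsDirectionalDeriv T)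
    (i : Fin n) : IsDirectionalDeriv fun φ => pderiv i (T φ) := by
  obtain ⟨k, v, h⟩ := hT
  refine ⟨k + 1, Fin.cons (Pi.single i 1) v, fun f hf => ?_⟩
  simp only [h f hf, pderiv_mk]
  refine mk_eq_mk ?_
  filter_upwards [hf] with y hy
  have hd : DifferentiableAt ℝ (iteratedFDeriv ℝ k f) y :=
    (hy.iteratedFDeriv_right (m := ∞) le_rfl).differentiableAt (by simp)
  rw [iteratedFDeriv_succ_apply_left, Fin.cons_zero, Fin.tail_cons]
  have h2 := ((ContinuousMultilinearMap.apply ℝ (fun _ : Fin k => Fin n → ℝ) ℝ v).hasFDerivAt.comp y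
    hd.hasFDerivAt).fderiv
  exact congrArg (fun F => F (Pi.single i 1)) h2

theorem IsDirectionalDeriv.iterate_pderiv {T : SmoothGerm n → SmoothGerm n}
    (hT : IsDirectionalDeriv T) (i : Fin n) (k : ℕ) :
    IsDirectionalDeriv fun φ => (SmoothGerm.pderiv i)^[k] (T φ) := by
  induction k with
  | zero => exact hT
  | succ k ih => simpa only [Function.iterate_succ_apply'] using ih.pderiv i

/-- This brings Taylor coefficients within reach of termwise differentiation and norm bounds, which
concern `iteratedFDeriv`. -/
theorem isDirectionalDeriv_iteratedPDeriv (α : Fin n →₀ ℕ) :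
    IsDirectionalDeriv (iteratedPDeriv α) := by
  have h : ∀ L : List (Fin n),
      IsDirectionalDeriv fun φ => L.foldr (fun i ψ => (SmoothGerm.pderiv i)^[α i] ψ) φ := by
    intro L
    induction L with
    | nil => exact IsDirectionalDeriv.id
    | cons i L ih => exact ih.iterate_pderiv i _
  exact h _

theorem smoothNearZero_of_contDiff {f : (Fin n → ℝ) → ℝ} (hf : ContDiff ℝ ∞ f) :
    SmoothNearZero f :=
  Eventually.of_forall fun _ => hf.contDiffAt

/-- The Taylor coefficients of a series of smooth functions whose derivatives are summable,
uniformly, are the sums of the Taylor coefficients. -/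
theorem coeff_tsum {ι : Type*} {f : ι → (Fin n → ℝ) → ℝ} {v : ℕ → ι → ℝ}
    (hf : ∀ i, ContDiff ℝ ∞ (f i)) (hv : ∀ k, Summable (v k))
    (h : ∀ k i x, ‖iteratedFDeriv ℝ k (f i) x‖ ≤ v k i)
    (hs : SmoothNearZero fun x => ∑' i, f i x) (α : Fin n →₀ ℕ) :
    coeff α (mk _ hs) = ∑' i, coeff α (mk _ (smoothNearZero_of_contDiff (hf i))) := by
  obtain ⟨k, w, hT⟩ := isDirectionalDeriv_iteratedPDeriv α
  simp only [coeff_eq, hT, value_mk]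
  rw [tsum_div_const, iteratedFDeriv_tsum_apply (N := ⊤) hf (fun k _ => hv k)
    (fun k i x _ => h k i x) le_top, ContinuousMultilinearMap.tsum_eval]
  exact Summable.of_norm_bounded (hv k) fun i => h k i 0

/-- A monomial, cut off and rescaled, so that its derivatives of small order are small. -/
theorem exists_contDiff_term (α : Fin n →₀ ℕ) (c : ℝ) {u : ℝ} (hu : 0 < u) :
    ∃ (f : (Fin n → ℝ) → ℝ) (hf : ContDiff ℝ ∞ f),
      mk f (smoothNearZero_of_contDiff hf) = term α c ∧
      (∀ k, ∃ B, ∀ x, ‖iteratedFDeriv ℝ k f x‖ ≤ B) ∧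
      ∀ k < α.degree, ∀ x, ‖iteratedFDeriv ℝ k f x‖ ≤ u := by
  let χ : ContDiffBump (0 : Fin n → ℝ) := ⟨1, 2, one_pos, one_lt_two⟩
  let h : (Fin n → ℝ) → ℝ := fun x => (c * ∏ i, x i ^ α i) * χ x
  have hh : ContDiff ℝ ∞ h := ContDiff.mul (by fun_prop) χ.contDiff
  have hc : HasCompactSupport h := χ.hasCompactSupport.mul_left
  have hB : ∀ k, ∃ B, ∀ x, ‖iteratedFDeriv ℝ k h x‖ ≤ B := fun k =>
    (hh.continuous_iteratedFDeriv (m := k) (by exact_mod_cast le_top)).bounded_above_of_compact_support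
      (hc.iteratedFDeriv k)
  choose B hB using hB
  have hB0 : ∀ k, 0 ≤ B k := fun k => (norm_nonneg _).trans (hB k 0)
  set M := ∑ k ∈ Finset.range α.degree, B k with hM
  have hM0 : 0 ≤ M := Finset.sum_nonneg fun k _ => hB0 k
  -- Dividing by `M + 1` rather than `M` covers the case `M = 0`.
  obtain ⟨ε, hε0, hε1, hεM⟩ : ∃ ε : ℝ, 0 < ε ∧ ε ≤ 1 ∧ ε * M ≤ u := by
    refine ⟨min 1 (u / (M + 1)), by positivity, min_le_left _ _, ?_⟩
    calc min 1 (u / (M + 1)) * M ≤ u / (M + 1) * (M + 1) := by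
          gcongr
          · exact min_le_right _ _
          · linarith
      _ = u := by field_simp
  -- By homogeneity `f` is still `c X^α` near the origin, while its `k`-th derivative is scaled by
  -- `ε ^ (|α| - k)`, which contains a factor `ε` when `k < |α|`.
  let f : (Fin n → ℝ) → ℝ := fun x => ε ^ α.degree • h (ε⁻¹ • x)
  have hha : ContDiff ℝ ∞ fun x => h (ε⁻¹ • x) := hh.comp (contDiff_const_smul _)
  have hf : ContDiff ℝ ∞ f := hha.const_smul _
  have hD : ∀ k x, ‖iteratedFDeriv ℝ k f x‖ = ε ^ α.degree * (ε⁻¹ ^ k *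
      ‖iteratedFDeriv ℝ k h (ε⁻¹ • x)‖) := by
    intro k x
    have h1 : (k : ℕ∞ω) ≤ ∞ := by exact_mod_cast le_top
    have h2 := iteratedFDeriv_const_smul_apply' (a := ε ^ α.degree)
      (hha.of_le h1).contDiffAt (x := x)
    rw [show iteratedFDeriv ℝ k f x = _ from h2, iteratedFDeriv_comp_const_smul _ (hh.of_le h1),
      norm_smul, norm_smul, Real.norm_of_nonneg (by positivity), Real.norm_of_nonneg (by positivity)]
  refine ⟨f, hf, mk_eq_mk ?_, fun k => ⟨ε ^ α.degree * (ε⁻¹ ^ k * B k), fun x => ?_⟩,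
    fun k hk x => ?_⟩
  · have ht : Tendsto (fun x : Fin n → ℝ => ε⁻¹ • x) (𝓝 0) (𝓝 0) := by
      simpa using (continuous_const_smul ε⁻¹).tendsto (0 : Fin n → ℝ)
    filter_upwards [ht.eventually χ.eventuallyEq_one] with x hx
    have h1 : ∏ i, ε ^ α i = ε ^ α.degree := by
      rw [Finset.prod_pow_eq_pow_sum, Finsupp.degree_eq_sum]
    have h2 : ∏ i, (ε⁻¹ • x) i ^ α i = (ε ^ α.degree)⁻¹ * ∏ i, x i ^ α i := by
      rw [← h1, ← Finset.prod_inv_distrib, ← Finset.prod_mul_distrib]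
      simp [mul_pow]
    simp only [f, h, hx, h2, smul_eq_mul, Pi.one_apply]
    field_simp
  · rw [hD]
    gcongr
    exact hB k _
  · rw [hD]
    obtain ⟨d, hd⟩ := Nat.exists_eq_add_of_lt hk
    calc ε ^ α.degree * (ε⁻¹ ^ k * ‖iteratedFDeriv ℝ k h (ε⁻¹ • x)‖)
        = ε ^ d * (ε * ‖iteratedFDeriv ℝ k h (ε⁻¹ • x)‖) := by
          generalize ‖iteratedFDeriv ℝ k h (ε⁻¹ • x)‖ = N
          rw [hd, inv_pow, pow_succ, pow_add]
          field_simp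
      _ ≤ 1 * (ε * M) := by
          gcongr
          · exact pow_le_one₀ hε0.le hε1
          · exact (hB k _).trans
              (Finset.single_le_sum (fun k _ => hB0 k) (Finset.mem_range.2 hk))
      _ ≤ u := by rwa [one_mul]

/-- Borel's theorem. -/
theorem jet_surjective : Function.Surjective (jet : SmoothGerm n → MvPowerSeries (Fin n) ℝ) := by
  classical
  intro F
  obtain ⟨u, hu, s, hus, -⟩ := posSumOfEncodable one_pos (Fin n →₀ ℕ)
  choose f hf hterm hB hsmall using fun α : Fin n →₀ ℕ =>
    exists_contDiff_term α (MvPowerSeries.coeff α F) (hu α)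
  choose B hB using hB
  -- For fixed `k` the bound `B α k` serves only the finitely many `α` of degree at most `k`, so
  -- summability comes from `u`.
  let v : ℕ → (Fin n →₀ ℕ) → ℝ := fun k α => if k < α.degree then u α else B α k
  have hv : ∀ k, Summable (v k) := by
    intro k
    have hev : ∀ᶠ α : Fin n →₀ ℕ in cofinite, k < α.degree := by
      rw [eventually_cofinite]
      simpa only [not_lt] using Finsupp.finite_of_degree_le (σ := Fin n) k
    refine hus.summable.of_norm_bounded_eventually ?_
    filter_upwards [hev] with α hα
    simp [v, hα, abs_of_pos (hu α)]
  have hle : ∀ k α x, ‖iteratedFDeriv ℝ k (f α) x‖ ≤ v k α := by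
    intro k α x
    by_cases hk : k < α.degree
    · simpa only [v, if_pos hk] using hsmall α k hk x
    · simpa only [v, if_neg hk] using hB α k x
  have hs : ContDiff ℝ ∞ fun x => ∑' α, f α x :=
    contDiff_tsum (N := ⊤) hf (fun k _ => hv k) fun k α x _ => hle k α x
  refine ⟨mk _ (smoothNearZero_of_contDiff hs), ?_⟩
  ext α
  change coeff α _ = _
  rw [coeff_tsum hf hv hle]
  simp only [hterm, coeff_term]
  simp

/-! ### Taylor coefficients and divisibility of terms. -/

theorem coeff_add (α : Fin n →₀ ℕ) (φ ψ : SmoothGerm n) :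
    coeff α (φ + ψ) = coeff α φ + coeff α ψ := by
  simp only [coeff, jet_add, map_add]

theorem coeff_sub (α : Fin n →₀ ℕ) (φ ψ : SmoothGerm n) :
    coeff α (φ - ψ) = coeff α φ - coeff α ψ := by
  simp only [coeff, ← jetHom_apply, map_sub]

theorem coeff_zero (α : Fin n →₀ ℕ) : coeff α (0 : SmoothGerm n) = 0 := by
  simp only [coeff, jet_zero, map_zero]

theorem coeff_const_mul (α : Fin n →₀ ℕ) (c : ℝ) (φ : SmoothGerm n) :
    coeff α (const c * φ) = c * coeff α φ := by
  simp only [coeff, jet_mul, jet_const, MvPowerSeries.coeff_C_mul]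

theorem isFlat_iff {φ : SmoothGerm n} : φ.IsFlat ↔ ∀ α, coeff α φ = 0 :=
  MvPowerSeries.ext_iff

theorem IsFlat.add {φ ψ : SmoothGerm n} (hφ : φ.IsFlat) (hψ : ψ.IsFlat) : (φ + ψ).IsFlat := by
  rw [IsFlat, jet_add, hφ, hψ, add_zero]

theorem exists_le_of_coeff_mul_ne_zero {α : Fin n →₀ ℕ} {φ ψ : SmoothGerm n}
    (h : coeff α (φ * ψ) ≠ 0) : ∃ β ≤ α, coeff β ψ ≠ 0 := by
  classical
  rw [coeff, jet_mul, MvPowerSeries.coeff_mul] at h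
  obtain ⟨p, hp, hne⟩ := Finset.exists_ne_zero_of_sum_ne_zero h
  exact ⟨p.2, Finset.HasAntidiagonal.antidiagonal.snd_le hp, right_ne_zero_of_mul hne⟩

theorem coeff_term_same (α : Fin n →₀ ℕ) (c : ℝ) : coeff α (term α c) = c := by
  rw [coeff_term, if_pos rfl]

theorem eq_of_coeff_term_ne_zero {α β : Fin n →₀ ℕ} {c : ℝ} (h : coeff β (term α c) ≠ 0) :
    β = α := by
  by_contra hne
  exact h (by rw [coeff_term, if_neg hne])

theorem const_mul_const (c d : ℝ) : const c * const d = (const (c * d) : SmoothGerm n) := rfl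

theorem term_mul_term (α β : Fin n →₀ ℕ) (c d : ℝ) :
    term α c * term β d = term (α + β) (c * d) := by
  simp only [term_eq, Finsupp.add_apply, pow_add, Finset.prod_mul_distrib, ← const_mul_const]
  ring

theorem term_dvd_term_iff {α β : Fin n →₀ ℕ} {c d : ℝ} (hc : c ≠ 0) (hd : d ≠ 0) :
    term α c ∣ term β d ↔ α ≤ β := by
  constructor
  · rintro ⟨φ, hφ⟩
    have h : coeff β (φ * term α c) ≠ 0 := by
      rw [mul_comm, ← hφ, coeff_term_same]
      exact hd
    obtain ⟨γ, hγ, hne⟩ := exists_le_of_coeff_mul_ne_zero h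
    rwa [eq_of_coeff_term_ne_zero hne] at hγ
  · intro h
    obtain ⟨γ, rfl⟩ := exists_add_of_le h
    exact ⟨term γ (d / c), by rw [term_mul_term, mul_div_cancel₀ _ hc]⟩

theorem term_ne_zero {α : Fin n →₀ ℕ} {c : ℝ} (hc : c ≠ 0) : term α c ≠ 0 := by
  intro h
  apply hc
  rw [← coeff_term_same α c, h, coeff_zero]

end SmoothGerm

/-! ### Division of power series along a local order. -/

namespace LocalOrder

open SmoothGerm

variable {n : ℕ} (o : LocalOrder n)

/-- By Dickson's lemma an infinite `≺`-increasing sequence has an earlier entry dividing a later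
one; but a multiple is never larger. -/
theorem wellFounded_gt : WellFounded (fun α β => o.lt β α) := by
  have := o.isStrictTotalOrder
  rw [RelEmbedding.wellFounded_iff_isEmpty]
  refine ⟨fun e => ?_⟩
  obtain ⟨a, b, hab, hle⟩ :=
    (wellQuasiOrderedLE_def (Fin n →₀ ℕ)).1 inferInstance (fun k => e k)
  have h2 : o.lt (e a) (e b) := e.map_rel_iff.2 hab
  rcases o.eq_or_lt_of_le hle with h3 | h3
  · rw [h3] at h2
    exact irrefl _ h2
  · exact irrefl _ (_root_.trans h2 h3)

theorem lt_irrefl (α : Fin n →₀ ℕ) : ¬ o.lt α α :=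
  have := o.isStrictTotalOrder
  irrefl α

open MvPowerSeries in
/-- Division of formal power series with respect to a local order. -/
theorem exists_division (A : Finset (Fin n →₀ ℕ))
    (g : (Fin n →₀ ℕ) → MvPowerSeries (Fin n) ℝ)
    (hg1 : ∀ β ∈ A, MvPowerSeries.coeff β (g β) = 1)
    (hg : ∀ β ∈ A, ∀ γ, MvPowerSeries.coeff γ (g β) ≠ 0 → γ ≠ β → o.lt γ β)
    (F : MvPowerSeries (Fin n) ℝ) :
    ∃ (q : (Fin n →₀ ℕ) → MvPowerSeries (Fin n) ℝ) (r : MvPowerSeries (Fin n) ℝ),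
      F = ∑ β ∈ A, q β * g β + r ∧
      ∀ γ, ∀ β ∈ A, β ≤ γ → MvPowerSeries.coeff γ r = 0 := by
  classical
  obtain ⟨b, hb⟩ : ∃ b : (Fin n →₀ ℕ) → (Fin n →₀ ℕ),
      ∀ γ, (∃ β ∈ A, β ≤ γ) → b γ ∈ A ∧ b γ ≤ γ :=
    Classical.axiomOfChoice (r := fun γ β => (∃ β ∈ A, β ≤ γ) → β ∈ A ∧ β ≤ γ) fun γ => by
      by_cases h : ∃ β ∈ A, β ≤ γ
      · exact h.imp fun β hβ _ => hβ
      · exact ⟨0, fun h' => absurd h' h⟩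
  -- `V γ β` says that the monomial `X^γ` is to be cancelled using `g β`; at most one `β` serves
  -- each `γ`.
  let V : (Fin n →₀ ℕ) → (Fin n →₀ ℕ) → Prop := fun γ β => (∃ β ∈ A, β ≤ γ) ∧ b γ = β
  -- `c δ` is what is left at `X^δ` once all larger monomials have been treated. It is defined by
  -- recursion from large to small monomials; the antidiagonal is finite, so no limit is needed.
  obtain ⟨c, hc⟩ : ∃ c : (Fin n →₀ ℕ) → ℝ, ∀ δ, c δ = coeff δ F -
      ∑ β ∈ A, ∑ p ∈ Finset.HasAntidiagonal.antidiagonal δ,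
        if o.lt δ (p.1 + β) ∧ V (p.1 + β) β then c (p.1 + β) * coeff p.2 (g β) else 0 := by
    let step : ∀ δ, (∀ γ, o.lt δ γ → ℝ) → ℝ := fun δ rec => coeff δ F -
      ∑ β ∈ A, ∑ p ∈ Finset.HasAntidiagonal.antidiagonal δ,
        if h : o.lt δ (p.1 + β) ∧ V (p.1 + β) β then rec (p.1 + β) h.1 * coeff p.2 (g β) else 0
    refine ⟨o.wellFounded_gt.fix step, fun δ => ?_⟩
    rw [WellFounded.fix_eq]
    simp only [step, dite_eq_ite]
  let q : (Fin n →₀ ℕ) → MvPowerSeries (Fin n) ℝ := fun β a =>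
    if V (a + β) β then c (a + β) else 0
  let r : MvPowerSeries (Fin n) ℝ := fun γ => if ∃ β ∈ A, β ≤ γ then 0 else c γ
  have hq : ∀ β a, coeff a (q β) = if V (a + β) β then c (a + β) else 0 := fun _ _ => rfl
  have hr : ∀ γ, coeff γ r = if ∃ β ∈ A, β ≤ γ then 0 else c γ := fun _ => rfl
  refine ⟨q, r, ?_, fun γ β hβ hle => by rw [hr, if_pos ⟨β, hβ, hle⟩]⟩
  ext δ
  -- If `p.2 ≠ β` and the coefficient is nonzero, then `p.2 ≺ β`, so only values of `c` above `δ`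
  -- enter. The case `p.2 = β` contributes `c δ` itself.
  have hterm : ∀ β ∈ A, ∀ p ∈ Finset.HasAntidiagonal.antidiagonal δ, coeff p.1 (q β) * coeff p.2 (g β) =
      (if o.lt δ (p.1 + β) ∧ V (p.1 + β) β then c (p.1 + β) * coeff p.2 (g β) else 0) +
        if p.2 = β ∧ V δ β then c δ else 0 := by
    intro β hβ p hp
    rw [Finset.HasAntidiagonal.mem_antidiagonal] at hp
    rw [hq]
    by_cases hpβ : p.2 = β
    · have h1 : p.1 + β = δ := by rw [← hpβ, hp]
      rw [h1, hpβ, hg1 β hβ]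
      simp [o.lt_irrefl]
    · rw [if_neg (fun h : p.2 = β ∧ V δ β => hpβ h.1), add_zero]
      by_cases h0 : coeff p.2 (g β) = 0
      · simp [h0]
      · have h1 : o.lt δ (p.1 + β) := by
          rw [← hp, add_comm p.1, add_comm p.1]
          exact o.lt_add_right _ _ _ (hg β hβ _ h0 hpβ)
        simp only [h1, true_and, ite_mul, zero_mul]
  -- Exactly one place receives `c δ`: the quotient of `b δ`, at the pair `(δ - b δ, b δ)`, or else
  -- the remainder.
  have hlast : (∑ β ∈ A, ∑ p ∈ Finset.HasAntidiagonal.antidiagonal δ, if p.2 = β ∧ V δ β then c δ else 0) +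
      coeff δ r = c δ := by
    rw [hr]
    by_cases h : ∃ β ∈ A, β ≤ δ
    · rw [if_pos h, add_zero]
      obtain ⟨hbA, hbδ⟩ := hb δ h
      rw [Finset.sum_eq_single_of_mem _ hbA, Finset.sum_eq_single_of_mem (δ - b δ, b δ)]
      · exact if_pos ⟨rfl, h, rfl⟩
      · rw [Finset.HasAntidiagonal.mem_antidiagonal]
        exact tsub_add_cancel_of_le hbδ
      · rintro ⟨p1, p2⟩ hp hne
        refine if_neg ?_
        rintro ⟨rfl, -⟩
        rw [Finset.HasAntidiagonal.mem_antidiagonal] at hp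
        exact hne (Prod.ext (eq_tsub_of_add_eq hp) rfl)
      · intro β _ hne
        exact Finset.sum_eq_zero fun p _ => if_neg fun h' => hne h'.2.2.symm
    · rw [if_neg h, Finset.sum_eq_zero, zero_add]
      intro β _
      exact Finset.sum_eq_zero fun p _ => if_neg fun h' => h h'.2.1
  rw [map_add, map_sum]
  simp only [coeff_mul]
  rw [Finset.sum_congr rfl fun β hβ => Finset.sum_congr rfl (hterm β hβ)]
  simp only [Finset.sum_add_distrib]
  rw [add_assoc, hlast, hc δ]
  ring

/-! ### Leading exponents, corners and reduced germs. -/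

variable {o}

theorem IsLeadingExponent.not_isFlat {φ : SmoothGerm n} {α : Fin n →₀ ℕ}
    (h : o.IsLeadingExponent φ α) : ¬ φ.IsFlat := fun hf => h.1 (isFlat_iff.1 hf α)

theorem IsLeadingExponent.unique {φ : SmoothGerm n} {α β : Fin n →₀ ℕ}
    (hα : o.IsLeadingExponent φ α) (hβ : o.IsLeadingExponent φ β) : α = β := by
  have := o.isStrictTotalOrder
  by_contra hne
  exact o.lt_irrefl α (_root_.trans (hβ.2 α hα.1 hne) (hα.2 β hβ.1 (Ne.symm hne)))

theorem IsLeadingExponent.leadingCoeff_eq {φ : SmoothGerm n} {α : Fin n →₀ ℕ}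
    (h : o.IsLeadingExponent φ α) : o.leadingCoeff φ = SmoothGerm.coeff α φ := by
  rw [leadingCoeff, dif_neg h.not_isFlat]
  exact congrArg (SmoothGerm.coeff · φ)
    ((o.exists_isLeadingExponent h.not_isFlat).choose_spec.unique h)

theorem IsLeadingExponent.leadingTerm_eq {φ : SmoothGerm n} {α : Fin n →₀ ℕ}
    (h : o.IsLeadingExponent φ α) : o.leadingTerm φ = term α (SmoothGerm.coeff α φ) := by
  rw [leadingTerm, dif_neg h.not_isFlat, h.leadingCoeff_eq]
  exact congrArg (term · (SmoothGerm.coeff α φ))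
    ((o.exists_isLeadingExponent h.not_isFlat).choose_spec.unique h)

theorem leadingTerm_of_isFlat {φ : SmoothGerm n} (h : φ.IsFlat) : o.leadingTerm φ = 0 := by
  rw [leadingTerm, dif_pos h]

variable (o)

/-- The exponents of the leading monomials of the members of an ideal. -/
def leadingExponents (I : Ideal (SmoothGerm n)) : Set (Fin n →₀ ℕ) :=
  {α | ∃ f ∈ I, o.IsLeadingExponent f α}

/-- The minimal exponents, for divisibility, of the leading monomials of the members of an ideal. -/
def corners (I : Ideal (SmoothGerm n)) : Set (Fin n →₀ ℕ) :=
  {α | Minimal (· ∈ o.leadingExponents I) α}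

theorem finite_corners (I : Ideal (SmoothGerm n)) : (o.corners I).Finite :=
  WellQuasiOrderedLE.finite_of_isAntichain (setOfPred_minimal_antichain _)

variable {o} {I : Ideal (SmoothGerm n)}

theorem exists_corner_le {α : Fin n →₀ ℕ} (h : α ∈ o.leadingExponents I) :
    ∃ β ∈ o.corners I, β ≤ α := by
  obtain ⟨β, hle, hβ⟩ := exists_minimal_le_of_wellFoundedLT (· ∈ o.leadingExponents I) α h
  exact ⟨β, hβ, hle⟩

theorem isFlat_of_coeff_eq_zero {f : SmoothGerm n} (hf : f ∈ I)
    (h : ∀ γ, ∀ β ∈ o.corners I, β ≤ γ → SmoothGerm.coeff γ f = 0) : f.IsFlat := by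
  by_contra hflat
  obtain ⟨α, hα⟩ := o.exists_isLeadingExponent hflat
  obtain ⟨β, hβ, hle⟩ := exists_corner_le (o := o) ⟨f, hf, hα⟩
  exact hα.1 (h α β hβ hle)

open Classical in
/-- The germ `f` has the monomial `X^α`, with coefficient one, and no other monomial that is
divisible by the leading monomial of a member of `I`. -/
def IsReducedAt (o : LocalOrder n) (I : Ideal (SmoothGerm n)) (α : Fin n →₀ ℕ)
    (f : SmoothGerm n) : Prop :=
  ∀ γ, ∀ β ∈ o.corners I, β ≤ γ → SmoothGerm.coeff γ f = if γ = α then 1 else 0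

theorem IsReducedAt.coeff_self {α : Fin n →₀ ℕ} {f : SmoothGerm n} (h : IsReducedAt o I α f)
    (hα : α ∈ o.corners I) : SmoothGerm.coeff α f = 1 := by
  rw [h α α hα le_rfl, if_pos rfl]

/-- The leading exponent of `f` lies above a corner, and `α` is the only exponent of `f` that does.
-/
theorem IsReducedAt.isLeadingExponent {α : Fin n →₀ ℕ} {f : SmoothGerm n}
    (h : IsReducedAt o I α f) (hα : α ∈ o.corners I) (hf : f ∈ I) :
    o.IsLeadingExponent f α := by
  have hflat : ¬ f.IsFlat := fun hflat => by
    simpa [h.coeff_self hα] using isFlat_iff.1 hflat α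
  obtain ⟨δ, hδ⟩ := o.exists_isLeadingExponent hflat
  obtain ⟨β, hβ, hle⟩ := exists_corner_le (o := o) ⟨f, hf, hδ⟩
  have : δ = α := by
    by_contra hne
    exact hδ.1 (by rw [h δ β hβ hle, if_neg hne])
  rwa [← this]

theorem IsReducedAt.isFlat_sub {α : Fin n →₀ ℕ} {f g : SmoothGerm n} (hf : IsReducedAt o I α f)
    (hg : IsReducedAt o I α g) (hfI : f ∈ I) (hgI : g ∈ I) : (f - g).IsFlat := by
  refine isFlat_of_coeff_eq_zero (o := o) (I.sub_mem hfI hgI) fun γ β hβ hle => ?_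
  rw [coeff_sub, hf γ β hβ hle, hg γ β hβ hle, sub_self]

/-- Division of germs by monic members of an ideal, one for each corner. -/
theorem exists_division_corners {A : Finset (Fin n →₀ ℕ)} (hA : ∀ α, α ∈ A ↔ α ∈ o.corners I)
    {g : (Fin n →₀ ℕ) → SmoothGerm n} (hg1 : ∀ β ∈ A, SmoothGerm.coeff β (g β) = 1)
    (hg : ∀ β ∈ A, o.IsLeadingExponent (g β) β) (f : SmoothGerm n) :
    ∃ q : (Fin n →₀ ℕ) → SmoothGerm n, ∀ γ, ∀ β ∈ o.corners I, β ≤ γ →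
      SmoothGerm.coeff γ (f - ∑ β ∈ A, q β * g β) = 0 := by
  obtain ⟨q, r, hqr, hr⟩ := o.exists_division A (fun β => jet (g β)) hg1
    (fun β hβ => (hg β hβ).2) (jet f)
  -- Only the quotients are lifted, by Borel's theorem; the remainder is then a difference of germs
  -- whose jet is `r`.
  choose Q hQ using fun β => jet_surjective (q β)
  refine ⟨Q, fun γ β hβ hle => ?_⟩
  have : jet (f - ∑ β ∈ A, Q β * g β) = r := by
    simp only [← jetHom_apply, map_sub, map_sum, map_mul] at hqr ⊢
    rw [hqr]
    simp [hQ]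
  rw [SmoothGerm.coeff, this]
  exact hr γ β ((hA β).2 hβ) hle

/-- Divide `X^α` by monic members of `I`: `X^α` minus the remainder lies in `I`, and the remainder
has no monomial above a corner. -/
theorem exists_isReducedAt (o : LocalOrder n) (I : Ideal (SmoothGerm n)) (α : Fin n →₀ ℕ) :
    ∃ f ∈ I, IsReducedAt o I α f := by
  classical
  have h : ∀ β, ∃ f : SmoothGerm n, β ∈ o.corners I →
      f ∈ I ∧ SmoothGerm.coeff β f = 1 ∧ o.IsLeadingExponent f β := by
    intro β
    by_cases hβ : β ∈ o.corners I
    · obtain ⟨f, hf, hβf⟩ := hβ.prop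
      have hc := inv_ne_zero hβf.1
      refine ⟨const (SmoothGerm.coeff β f)⁻¹ * f, fun _ => ⟨I.mul_mem_left _ hf, ?_, ?_, ?_⟩⟩
      · rw [coeff_const_mul, inv_mul_cancel₀ hβf.1]
      · rw [coeff_const_mul]
        exact mul_ne_zero hc hβf.1
      · intro γ hγ
        rw [coeff_const_mul] at hγ
        exact hβf.2 γ (right_ne_zero_of_mul hγ)
    · exact ⟨0, fun h => absurd h hβ⟩
  choose g hg using h
  have hA : ∀ β, β ∈ (o.finite_corners I).toFinset ↔ β ∈ o.corners I := fun β => by simp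
  obtain ⟨q, hq⟩ := exists_division_corners hA (fun β hβ => (hg β ((hA β).1 hβ)).2.1)
    (fun β hβ => (hg β ((hA β).1 hβ)).2.2) (term α 1)
  refine ⟨∑ β ∈ (o.finite_corners I).toFinset, q β * g β,
    I.sum_mem fun β hβ => I.mul_mem_left _ (hg β ((hA β).1 hβ)).1, fun γ β hβ hle => ?_⟩
  have := hq γ β hβ hle
  rw [coeff_sub, coeff_term, sub_eq_zero] at this
  rw [← this]

/-! ### Existence. -/

theorem mem_leadingTermIdeal {f : SmoothGerm n} (hf : f ∈ I) :
    o.leadingTerm f ∈ o.leadingTermIdeal I :=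
  Ideal.subset_span ⟨f, hf, rfl⟩

theorem exists_isReducedStandardBasis (o : LocalOrder n) {I : Ideal (SmoothGerm n)} (hI : I.FG) :
    ∃ G : Finset (SmoothGerm n), o.IsReducedStandardBasis I G := by
  classical
  obtain ⟨s, hs⟩ := hI
  choose g hg using exists_isReducedAt o I
  set A := (o.finite_corners I).toFinset with hAdef
  have hA : ∀ β, β ∈ A ↔ β ∈ o.corners I := fun β => by simp [hAdef]
  have hgI : ∀ β ∈ A, g β ∈ I := fun β _ => (hg β).1
  have hgr : ∀ β ∈ A, IsReducedAt o I β (g β) := fun β _ => (hg β).2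
  have hg1 : ∀ β ∈ A, SmoothGerm.coeff β (g β) = 1 := fun β hβ =>
    (hgr β hβ).coeff_self ((hA β).1 hβ)
  have hgl : ∀ β ∈ A, o.IsLeadingExponent (g β) β := fun β hβ =>
    (hgr β hβ).isLeadingExponent ((hA β).1 hβ) (hgI β hβ)
  have hgt : ∀ β ∈ A, o.leadingTerm (g β) = term β 1 := fun β hβ => by
    rw [(hgl β hβ).leadingTerm_eq, hg1 β hβ]
  choose q hq using exists_division_corners hA hg1 hgl
  -- The remainder of a member of `I` is flat. The remainders of the generators in `s` restore
  -- generation of `I` without affecting leading terms.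
  let φ : SmoothGerm n → SmoothGerm n := fun f => f - ∑ β ∈ A, q f β * g β
  have hφI : ∀ f ∈ I, φ f ∈ I := fun f hf =>
    I.sub_mem hf (I.sum_mem fun β hβ => I.mul_mem_left _ (hgI β hβ))
  have hφ : ∀ f ∈ I, (φ f).IsFlat := fun f hf => isFlat_of_coeff_eq_zero (o := o) (hφI f hf) (hq f)
  have hsI : ∀ f ∈ s, f ∈ I := fun f hf => hs ▸ Ideal.subset_span hf
  have hG : ∀ x ∈ A.image g ∪ s.image φ, (∃ β ∈ A, g β = x) ∨ x ∈ I ∧ x.IsFlat := by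
    intro x hx
    rcases Finset.mem_union.1 hx with hx | hx
    · exact Or.inl (Finset.mem_image.1 hx)
    · obtain ⟨f, hf, rfl⟩ := Finset.mem_image.1 hx
      exact Or.inr ⟨hφI f (hsI f hf), hφ f (hsI f hf)⟩
  have hgG : ∀ β ∈ A, g β ∈ ((A.image g ∪ s.image φ : Finset _) : Set (SmoothGerm n)) :=
    fun β hβ => Finset.mem_union_left _ (Finset.mem_image_of_mem g hβ)
  have hGI : ∀ x ∈ A.image g ∪ s.image φ, x ∈ I := by
    intro x hx
    obtain ⟨β, hβ, rfl⟩ | h := hG x hx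
    exacts [hgI β hβ, h.1]
  refine ⟨A.image g ∪ s.image φ, ⟨le_antisymm (Ideal.span_le.2 hGI) ?_, le_antisymm ?_ ?_⟩, ?_, ?_⟩
  · conv_lhs => rw [← hs]
    refine Ideal.span_le.2 fun f hf => ?_
    have hf' : f = φ f + ∑ β ∈ A, q f β * g β := by simp [φ]
    rw [hf']
    refine Ideal.add_mem _ (Ideal.subset_span ?_) (Ideal.sum_mem _ fun β hβ =>
      Ideal.mul_mem_left _ _ (Ideal.subset_span (hgG β hβ)))
    exact Finset.mem_union_right _ (Finset.mem_image_of_mem φ hf)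
  · refine Ideal.span_le.2 ?_
    rintro _ ⟨f, hf, rfl⟩
    by_cases hflat : f.IsFlat
    · rw [leadingTerm_of_isFlat hflat]
      exact Ideal.zero_mem _
    · obtain ⟨α, hα⟩ := o.exists_isLeadingExponent hflat
      obtain ⟨β, hβ, hle⟩ := exists_corner_le (o := o) ⟨f, hf, hα⟩
      rw [← hA] at hβ
      have hdvd : o.leadingTerm (g β) ∣ o.leadingTerm f := by
        rw [hα.leadingTerm_eq, hgt β hβ]
        exact (term_dvd_term_iff one_ne_zero hα.1).2 hle
      exact Ideal.mem_of_dvd _ hdvd (Ideal.subset_span ⟨g β, hgG β hβ, rfl⟩)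
  · exact Ideal.span_mono (Set.image_mono hGI)
  · intro x hx hflat
    obtain ⟨β, hβ, rfl⟩ | h := hG x hx
    · rw [(hgl β hβ).leadingCoeff_eq, hg1 β hβ]
    · exact absurd h.2 hflat
  · rintro x hx y hy _ ⟨γ, hγ, rfl⟩ hdvd
    obtain ⟨α, hα, rfl⟩ | h := hG x hx
    · obtain ⟨β, hβ, rfl⟩ | h := hG y hy
      · rw [hgt α hα, term_dvd_term_iff one_ne_zero hγ] at hdvd
        have hγβ : γ = β := by
          by_contra hne
          exact hγ (by rw [hgr β hβ γ α ((hA α).1 hα) hdvd, if_neg hne])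
        subst hγβ
        -- Corners are minimal, so none lies strictly below another.
        have hαγ : α = γ := le_antisymm hdvd
          (((hA γ).1 hβ).le_of_le ((hA α).1 hα).prop hdvd)
        subst hαγ
        exact ⟨rfl, by rw [hgt α hα, hg1 α hα]⟩
      · exact absurd (isFlat_iff.1 h.2 γ) hγ
    · rw [leadingTerm_of_isFlat h.2, zero_dvd_iff] at hdvd
      exact absurd hdvd (term_ne_zero hγ)

/-! ### Uniqueness modulo flat germs. -/

/-- Multiplying by a germ only moves exponents upwards, and flat members of `G` contribute the
generator `0`. -/
theorem exists_leadingExponent_le_of_mem_span {G : Set (SmoothGerm n)} {f : SmoothGerm n}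
    (hf : f ∈ Ideal.span (o.leadingTerm '' G)) {γ : Fin n →₀ ℕ} (hγ : SmoothGerm.coeff γ f ≠ 0) :
    ∃ g ∈ G, ∃ δ ≤ γ, o.IsLeadingExponent g δ := by
  induction hf using Submodule.span_induction generalizing γ with
  | mem x hx =>
    obtain ⟨g, hg, rfl⟩ := hx
    by_cases hflat : g.IsFlat
    · rw [leadingTerm_of_isFlat hflat, coeff_zero] at hγ
      exact absurd rfl hγ
    · obtain ⟨δ, hδ⟩ := o.exists_isLeadingExponent hflat
      rw [hδ.leadingTerm_eq] at hγ
      exact ⟨g, hg, δ, (eq_of_coeff_term_ne_zero hγ).ge, hδ⟩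
  | zero => exact absurd (coeff_zero γ) hγ
  | add x y _ _ hx hy =>
    rw [coeff_add] at hγ
    by_cases h : SmoothGerm.coeff γ x = 0
    · exact hy (by rwa [h, zero_add] at hγ)
    · exact hx h
  | smul a x _ hx =>
    obtain ⟨β, hβ, hne⟩ := exists_le_of_coeff_mul_ne_zero hγ
    obtain ⟨g, hg, δ, hδ, h⟩ := hx hne
    exact ⟨g, hg, δ, hδ.trans hβ, h⟩

theorem IsStandardBasis.mem {G : Finset (SmoothGerm n)} (hG : o.IsStandardBasis I G)
    {g : SmoothGerm n} (hg : g ∈ G) : g ∈ I :=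
  hG.1 ▸ Ideal.subset_span hg

theorem IsStandardBasis.exists_leadingExponent_le {G : Finset (SmoothGerm n)}
    (hG : o.IsStandardBasis I G) {γ : Fin n →₀ ℕ} (hγ : γ ∈ o.leadingExponents I) :
    ∃ g ∈ G, ∃ δ ≤ γ, o.IsLeadingExponent g δ := by
  obtain ⟨f, hf, hγf⟩ := hγ
  have h := mem_leadingTermIdeal (o := o) hf
  rw [hG.2, hγf.leadingTerm_eq] at h
  exact exists_leadingExponent_le_of_mem_span h (by rw [coeff_term_same]; exact hγf.1)

namespace IsReducedStandardBasis

variable {G G' : Finset (SmoothGerm n)}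

theorem eq_of_leadingExponent_le (hG : o.IsReducedStandardBasis I G) {g h : SmoothGerm n}
    (hg : g ∈ G) (hh : h ∈ G) {α γ : Fin n →₀ ℕ} (hα : o.IsLeadingExponent g α)
    (hγ : SmoothGerm.coeff γ h ≠ 0) (hle : α ≤ γ) : g = h ∧ γ = α := by
  obtain ⟨h1, h2⟩ := hG.2.2 g hg h hh (term γ (SmoothGerm.coeff γ h)) ⟨γ, hγ, rfl⟩ (by
    rw [hα.leadingTerm_eq]
    exact (term_dvd_term_iff hα.1 hγ).2 hle)
  refine ⟨h1, eq_of_coeff_term_ne_zero (c := SmoothGerm.coeff α g) ?_⟩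
  rw [← hα.leadingTerm_eq, ← h2, coeff_term_same]
  exact hγ

theorem exists_isReducedAt (hG : o.IsReducedStandardBasis I G) {g : SmoothGerm n}
    (hg : g ∈ G) {α : Fin n →₀ ℕ} (hα : o.IsLeadingExponent g α) :
    α ∈ o.corners I ∧ IsReducedAt o I α g := by
  -- Some `g'` in `G` has its leading exponent below `β`, hence below `γ`; reducedness then forces
  -- `g' = g` and makes `γ` its leading exponent.
  have hcorner : ∀ γ, ∀ β ∈ o.corners I, β ≤ γ → SmoothGerm.coeff γ g ≠ 0 →
      γ = α ∧ α ≤ β := by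
    intro γ β hβ hle hγ
    obtain ⟨g', hg', δ, hδ, hδg⟩ := hG.1.exists_leadingExponent_le hβ.prop
    obtain ⟨rfl, rfl⟩ := hG.eq_of_leadingExponent_le hg' hg hδg hγ (hδ.trans hle)
    obtain rfl := hδg.unique hα
    exact ⟨rfl, hδ⟩
  have hαI : α ∈ o.leadingExponents I := ⟨g, hG.1.mem hg, hα⟩
  obtain ⟨β, hβ, hle⟩ := exists_corner_le hαI
  have hβα : β = α := le_antisymm hle (hcorner α β hβ hle hα.1).2
  refine ⟨hβα ▸ hβ, fun γ β hβ hle => ?_⟩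
  split_ifs with h
  · rw [h, ← hα.leadingCoeff_eq, hG.2.1 g hg hα.not_isFlat]
  · by_contra hne
    exact h (hcorner γ β hβ hle hne).1

/-- Some member of `G'` has leading exponent at most `α`, hence equal to `α` by minimality of
corners; both germs are then reduced at `α`. -/
theorem exists_isFlat_sub (hG : o.IsReducedStandardBasis I G)
    (hG' : o.IsReducedStandardBasis I G') {g : SmoothGerm n} (hg : g ∈ G) (hflat : ¬ g.IsFlat) :
    ∃ g' ∈ G', ¬ g'.IsFlat ∧ (g' - g).IsFlat := by
  obtain ⟨α, hα⟩ := o.exists_isLeadingExponent hflat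
  obtain ⟨hαc, hred⟩ := hG.exists_isReducedAt hg hα
  obtain ⟨g', hg', δ, hδ, hδg⟩ := hG'.1.exists_leadingExponent_le hαc.prop
  obtain rfl : δ = α := le_antisymm hδ (hαc.le_of_le ⟨g', hG'.1.mem hg', hδg⟩ hδ)
  exact ⟨g', hg', hδg.not_isFlat,
    (hG'.exists_isReducedAt hg' hδg).2.isFlat_sub hred (hG'.1.mem hg') (hG.1.mem hg)⟩

/-- Equal jets give `h` a term divisible by the leading term of `g`, which reducedness permits only
for `g = h`. -/
theorem eq_of_isFlat_sub (hG : o.IsReducedStandardBasis I G) {g h : SmoothGerm n}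
    (hg : g ∈ G) (hh : h ∈ G) (hflat : ¬ g.IsFlat) (hgh : (h - g).IsFlat) : g = h := by
  obtain ⟨α, hα⟩ := o.exists_isLeadingExponent hflat
  have h1 := isFlat_iff.1 hgh α
  rw [coeff_sub, sub_eq_zero] at h1
  exact (hG.eq_of_leadingExponent_le hg hh hα (h1 ▸ hα.1) le_rfl).1

end IsReducedStandardBasis

end LocalOrder

end

theorem mainTheorem3 (n : ℕ) (o : LocalOrder n) (I : Ideal (SmoothGerm n)) (hI : I.FG) :
    (∃ G : Finset (SmoothGerm n), o.IsReducedStandardBasis I G) ∧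
    ∀ G G' : Finset (SmoothGerm n),
      o.IsReducedStandardBasis I G → o.IsReducedStandardBasis I G' →
      ∃ e : {g : SmoothGerm n // g ∈ G ∧ ¬ g.IsFlat} ≃ {g : SmoothGerm n // g ∈ G' ∧ ¬ g.IsFlat},
        ∀ g, ((e g : SmoothGerm n) - (g : SmoothGerm n)).IsFlat := by
  refine ⟨o.exists_isReducedStandardBasis hI, fun G G' hG hG' => ?_⟩
  have key : ∀ {G G' : Finset (SmoothGerm n)}, o.IsReducedStandardBasis I G →
      o.IsReducedStandardBasis I G' → ∃ e : {g : SmoothGerm n // g ∈ G ∧ ¬ g.IsFlat} →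
        {g : SmoothGerm n // g ∈ G' ∧ ¬ g.IsFlat},
        ∀ g, ((e g : SmoothGerm n) - (g : SmoothGerm n)).IsFlat := by
    intro G G' hG hG'
    choose e he he' hflat using fun g : {g : SmoothGerm n // g ∈ G ∧ ¬ g.IsFlat} =>
      hG.exists_isFlat_sub hG' g.2.1 g.2.2
    exact ⟨fun g => ⟨e g, he g, he' g⟩, hflat⟩
  obtain ⟨e, he⟩ := key hG hG'
  obtain ⟨e', he'⟩ := key hG' hG
  -- Each composite changes a member of the basis by a flat germ and stays in that basis, so it is
  -- the identity.
  refine ⟨⟨e, e', fun g => Subtype.ext ?_, fun g => Subtype.ext ?_⟩, he⟩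
  · refine (hG.eq_of_isFlat_sub g.2.1 (e' (e g)).2.1 g.2.2 ?_).symm
    simpa using (he' (e g)).add (he g)
  · refine (hG'.eq_of_isFlat_sub g.2.1 (e (e' g)).2.1 g.2.2 ?_).symm
    simpa using (he (e' g)).add (he' g)
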